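/- An NCT circuit on a finite set of Boolean wires is a finite string of gates, applied from left to right, each of them a gate $\mathrm{NOT}(t): t\mapsto t\oplus 1$, $\mathrm{CNOT}(a;t): (a,t)\mapsto(a,t\oplus a)$ or $\mathrm{TOF}(a,b;t): (a,b,t)\mapsto(a,b,t\oplus ab)$ on distinct wires. A reversible function of $n$ variables is a bijection $f$ of $\{0,1\}^n$ onto itself. An ancilla is an additional input wire that carries a constant $0$ or $1$. A circuit with given ancillae implements $f$ - strongly, if it maps $x\mapsto f(x)$ and returns the ancillae to their original values; - intermediately, if it maps $(x,y)\mapsto(x,y\oplus f(x))$ for all $x,y\in\{0,1\}^n$ (bitwise exclusive or) and returns the ancillae to their original values; - weakly, if, for the input $x$, all $n$ components of $f(x)$ are among the functions of $x$ that it computes on its wires. Fix one of these three notions. For $a,b,c\in\{0,1\}$ and $g\ge1$ let $L_{a,b,c}(n,g)$ be the maximum, over all reversible functions $f$ of $n$ variables, of the smallest cost of an NCT circuit that implements $f$ with at most $g$ ancillae, where the cost of a circuit is $a$ times its number of NOT gates plus $b$ times its number of CNOT gates plus $c$ times its number of Toffoli gates (the cost is $\infty$ if there is no such circuit). Then, for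 each of the three notions of implementation and every $n\ge 0$: $$L_{0,1,0}(n,g)=0 \ \text{ and }\ L_{1,0,0}(n,g)=0 \ \text{ for all } g\ge1,\qquad L_{1,1,0}(n,g)=0\ \text{ for all } g\ge2.$$ More precisely, every reversible function of $n$ variables is implemented by an NCT circuit without CNOT gates whose only ancilla is set to $1$, by an NCT circuit without NOT gates whose only ancilla is set to $1$, and by a circuit of Toffoli gates only (no NOT and no CNOT gates) with exactly two ancillae, both set to $1$. -/

import Mathlib

namespace NCT

/-- The gates NOT, CNOT and Toffoli on a set `W` of wires; the wires of a gate are distinct,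
the last one is its target. -/
inductive Gate (W : Type) : Type
  | not (t : W) : Gate W
  | cnot (a t : W) (hat : a ≠ t) : Gate W
  | tof (a b t : W) (hab : a ≠ b) (hat : a ≠ t) (hbt : b ≠ t) : Gate W

/-- The action of a gate on an assignment of Boolean values to the wires. -/
def Gate.act {W : Type} [DecidableEq W] : Gate W → (W → Bool) → (W → Bool)
  | .not t, s => Function.update s t (xor (s t) true)
  | .cnot a t _, s => Function.update s t (xor (s t) (s a))
  | .tof a b t _ _ _, s => Function.update s t (xor (s t) (s a && s b))

/-- The weight of a gate, when NOT, CNOT and Toffoli gates have weights `a`, `b` and `c`. -/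
def Gate.weight {W : Type} (a b c : ℕ) : Gate W → ℕ
  | .not _ => a
  | .cnot _ _ _ => b
  | .tof _ _ _ _ _ _ => c

/-- A reversible circuit is a string of gates, read from left to right. -/
abbrev Circuit (W : Type) : Type := List (Gate W)

/-- The transformation computed by a circuit: the leftmost gate acts first. -/
def Circuit.run {W : Type} [DecidableEq W] (C : Circuit W) (s : W → Bool) : W → Bool :=
  List.foldl (fun s G => Gate.act G s) s C

/-- The cost of a circuit: the sum of the weights of its gates. -/
def Circuit.cost {W : Type} (a b c : ℕ) (C : Circuit W) : ℕ :=
  (List.map (Gate.weight a b c) C).sum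

/-- A reversible function of `n` Boolean variables. -/
abbrev RevFun (n : ℕ) : Type := Equiv.Perm (Fin n → Bool)

/-- Weak implementation: with the ancillae set to `anc`, all `n` outputs of `f` are found among
the functions computed on the wires. -/
def WeaklyImplements {n k : ℕ} (C : Circuit (Fin n ⊕ Fin k)) (anc : Fin k → Bool)
    (f : RevFun n) : Prop :=
  ∃ p : Fin n → Fin n ⊕ Fin k, ∀ (x : Fin n → Bool) (i : Fin n),
    C.run (Sum.elim x anc) (p i) = f x i

/-- Intermediate implementation: `(x, y) ↦ (x, y ⊕ f x)`, with the ancillae, set to `anc`,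
returned to their original values. -/
def IntermediatelyImplements {n k : ℕ} (C : Circuit ((Fin n ⊕ Fin n) ⊕ Fin k))
    (anc : Fin k → Bool) (f : RevFun n) : Prop :=
  ∀ x y : Fin n → Bool,
    C.run (Sum.elim (Sum.elim x y) anc) =
      Sum.elim (Sum.elim x (fun i => xor (y i) (f x i))) anc

/-- Strong implementation: `x ↦ f x`, with the ancillae, set to `anc`, returned to their
original values. -/
def StronglyImplements {n k : ℕ} (C : Circuit (Fin n ⊕ Fin k)) (anc : Fin k → Bool)
    (f : RevFun n) : Prop :=
  ∀ x : Fin n → Bool, C.run (Sum.elim x anc) = Sum.elim (f x) anc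

/-- The three notions of implementation of a reversible function by a circuit. -/
inductive Notion : Type
  | weak
  | intermediate
  | strong

/-- The costs of the circuits that implement `f`, in the given sense, with `k` ancillae
carrying the constants `anc`. -/
def costs (m : Notion) (a b c : ℕ) {n k : ℕ} (f : RevFun n) (anc : Fin k → Bool) : Set ℕ :=
  match m with
  | .weak =>
      {v | ∃ C : Circuit (Fin n ⊕ Fin k), WeaklyImplements C anc f ∧ C.cost a b c = v}
  | .intermediate =>
      {v | ∃ C : Circuit ((Fin n ⊕ Fin n) ⊕ Fin k),
        IntermediatelyImplements C anc f ∧ C.cost a b c = v}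
  | .strong =>
      {v | ∃ C : Circuit (Fin n ⊕ Fin k), StronglyImplements C anc f ∧ C.cost a b c = v}

/-- The smallest cost of an implementation of `f` with at most `g` ancillae, each carrying a
constant `0` or `1`; it is `⊤` when there is no implementation. -/
noncomputable def minCost (m : Notion) (a b c : ℕ) {n : ℕ} (f : RevFun n) (g : ℕ) : ℕ∞ :=
  ⨅ (k : ℕ) (_ : k ≤ g) (anc : Fin k → Bool) (v ∈ costs m a b c f anc), (v : ℕ∞)

/-- `L_{a,b,c}(n,g)`: the smallest cost of an implementation, with at most `g` ancillae, of the
most expensive reversible function of `n` variables. -/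
noncomputable def L (m : Notion) (a b c n g : ℕ) : ℕ∞ :=
  ⨆ f : RevFun n, minCost m a b c f g

end NCT

namespace NCT

/-! ### Multiply controlled NOTs from Toffoli gates -/

section Wires

variable {W : Type}

/-! Permutations implemented at cost zero with ancillae 1 form a monoid (`freePerms`). A control at
constant 1 turns CNOT into NOT and Toffoli into CNOT, so each gate set yields NOT and CNOT for free.
Toffoli gates build larger controlled NOTs with an ancilla as borrowed wire
(`exists_toffoli_circuit`). The fully controlled NOT is a transposition of adjacent hypercube
vertices; conjugation by NOTs gives all such, and they generate all permutations
(`eq_top_of_flip_mem_of_swap_mem`). -/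

theorem Circuit.cost_append (a b c : ℕ) (C D : Circuit W) :
    Circuit.cost a b c (C ++ D) = Circuit.cost a b c C + Circuit.cost a b c D := by
  simp [Circuit.cost]

variable [DecidableEq W]

/-- The multiply controlled NOT: the target `t` is negated when all wires in `P` carry `1`. -/
def mct (P : Finset W) (t : W) (s : W → Bool) : W → Bool :=
  Function.update s t (xor (s t) (decide (∀ p ∈ P, s p = true)))

theorem mct_of_forall {P : Finset W} {t : W} {s : W → Bool} (h : ∀ p ∈ P, s p = true) :
    mct P t s = Function.update s t (!s t) := by
  rw [mct, decide_eq_true h, Bool.xor_true]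

theorem mct_of_not_forall {P : Finset W} {t : W} {s : W → Bool} (h : ¬ ∀ p ∈ P, s p = true) :
    mct P t s = s := by
  rw [mct, decide_eq_false h, Bool.xor_false, Function.update_eq_self]

theorem Circuit.run_append (C D : Circuit W) (s : W → Bool) :
    Circuit.run (C ++ D) s = Circuit.run D (Circuit.run C s) := by
  simp [Circuit.run]

theorem Gate.act_tof (a b t : W) (hab : a ≠ b) (hat : a ≠ t) (hbt : b ≠ t) :
    (Gate.tof a b t hab hat hbt).act = mct {a, b} t := by
  funext s
  simp [Gate.act, mct]

/-- The commutator of two controlled gates through a borrowed wire `u` merges their controls. -/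
theorem mct_commutator {P : Finset W} {p t u : W} (hpt : p ≠ t) (htP : t ∉ P) (hpu : p ≠ u)
    (huP : u ∉ P) (htu : t ≠ u) (s : W → Bool) :
    mct P u (mct {u, p} t (mct P u (mct {u, p} t s))) = mct (insert p P) t s := by
  have key : ∀ (w : W) (s s' : W → Bool), w ∉ P → (∀ v, v ≠ w → s' v = s v) →
      decide (∀ q ∈ P, s' q = true) = decide (∀ q ∈ P, s q = true) := by
    intro w s s' hw h
    have : ∀ q ∈ P, s' q = s q := fun q hq => h q (fun e => hw (e ▸ hq))
    simp +contextual [this]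
  have kt : ∀ (s : W → Bool) (v : Bool), decide (∀ q ∈ P, Function.update s t v q = true) =
      decide (∀ q ∈ P, s q = true) := fun s v =>
    key t s _ htP (fun w hw => Function.update_of_ne hw _ _)
  have ku : ∀ (s : W → Bool) (v : Bool), decide (∀ q ∈ P, Function.update s u v q = true) =
      decide (∀ q ∈ P, s q = true) := fun s v =>
    key u s _ huP (fun w hw => Function.update_of_ne hw _ _)
  have hd : decide (∀ q ∈ insert p P, s q = true) =
      (s p && decide (∀ q ∈ P, s q = true)) := by
    simp
  have h2 : ∀ s : W → Bool, decide (∀ q ∈ ({u, p} : Finset W), s q = true) = (s u && s p) := by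
    intro s; simp
  unfold mct
  simp only [hd, h2, kt, ku]
  -- With `d` the conjunction over `P`, wire `t` receives `u p` and then `(u ⊕ d) p`, in total `d
  -- p`, while `u` receives `d` twice.
  generalize decide (∀ q ∈ P, s q = true) = d
  funext w
  by_cases hwt : w = t
  · subst hwt
    simp [hpt, hpu, htu, htu.symm]
    cases s w <;> cases s u <;> cases s p <;> cases d <;> rfl
  · by_cases hwu : w = u
    · subst hwu
      simp [Function.update_apply, hpt, hpu, hwt]
    · simp [hwt, hwu]

/-- A multiply controlled NOT with at least two controls and a borrowed wire is a product of
Toffoli gates. -/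
theorem exists_toffoli_circuit (a b : ℕ) (P : Finset W) (hP : 2 ≤ P.card) :
    ∀ t u : W, t ∉ P → u ∉ P → t ≠ u →
      ∃ C : Circuit W, C.cost a b 0 = 0 ∧ ∀ s, C.run s = mct P t s := by
  induction P using Finset.induction_on with
  | empty => simp at hP
  | insert p P hp ih =>
    intro t u ht hu htu
    simp only [Finset.mem_insert, not_or] at ht hu
    rw [Finset.card_insert_of_notMem hp] at hP
    rcases Nat.lt_or_ge P.card 2 with h1 | h2
    · obtain ⟨q, rfl⟩ := Finset.card_eq_one.mp (by omega : P.card = 1)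
      simp only [Finset.mem_singleton] at hp ht
      refine ⟨[.tof p q t hp (Ne.symm ht.1) (Ne.symm ht.2)], rfl, fun s => ?_⟩
      rw [← Gate.act_tof p q t hp (Ne.symm ht.1) (Ne.symm ht.2)]
      rfl
    -- Target and borrowed wire exchange roles here, so the induction must quantify over both.
    · obtain ⟨C, hC, hrun⟩ := ih h2 u t hu.2 ht.2 (Ne.symm htu)
      let G : Gate W := .tof u p t hu.1 (Ne.symm htu) (Ne.symm ht.1)
      have hG : ∀ s, Circuit.run [G] s = mct {u, p} t s := fun s => by
        rw [← Gate.act_tof u p t hu.1 (Ne.symm htu) (Ne.symm ht.1)]; rfl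
      have hG0 : Circuit.cost a b 0 [G] = 0 := rfl
      refine ⟨[G] ++ C ++ [G] ++ C, by simp only [Circuit.cost_append, hC, hG0], fun s => ?_⟩
      simp only [Circuit.run_append, hrun, hG]
      exact mct_commutator (Ne.symm ht.1) ht.2 (Ne.symm hu.1) hu.2 htu s

end Wires

/-! ### Generating all permutations -/

section Universality

variable {V : Type} [DecidableEq V]

/-- The permutations strongly implemented at cost zero with `k` ancillae set to `1`. -/
def freePerms (V : Type) [DecidableEq V] (a b c k : ℕ) : Submonoid (Equiv.Perm (V → Bool)) where
  carrier := {f | ∃ C : Circuit (V ⊕ Fin k), C.cost a b c = 0 ∧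
    ∀ x, C.run (Sum.elim x (fun _ => true)) = Sum.elim (f x) (fun _ => true)}
  one_mem' := ⟨[], rfl, fun _ => rfl⟩
  mul_mem' := by
    rintro f g ⟨C, hC, hCr⟩ ⟨D, hD, hDr⟩
    refine ⟨D ++ C, by simp [Circuit.cost_append, hC, hD], fun x => ?_⟩
    simp [Circuit.run_append, hCr, hDr]

/-- Negation of the value at `t`, as a permutation of the assignments. -/
def flip (t : V) : Equiv.Perm (V → Bool) :=
  Function.Involutive.toPerm (fun x => Function.update x t (!x t)) (fun x => by simp)

theorem flip_apply (t : V) (x : V → Bool) : flip t x = Function.update x t (!x t) := rfl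

theorem flip_flip (t : V) (x : V → Bool) : flip t (flip t x) = x := by
  simp [flip_apply]

theorem flip_comm (t i : V) (x : V → Bool) : flip t (flip i x) = flip i (flip t x) := by
  by_cases h : t = i
  · rw [h]
  · simp only [flip_apply, Function.update_of_ne h, Function.update_of_ne (Ne.symm h)]
    exact Function.update_comm (Ne.symm h) _ _ x

/-- The hypercube is connected: the coordinates of `x₀` can be corrected one at a time. -/
theorem flip_induction [Fintype V] {Q : (V → Bool) → Prop} (x₀ : V → Bool) (h₀ : Q x₀)
    (hflip : ∀ i x, Q x → Q (flip i x)) (x : V → Bool) : Q x := by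
  have key : ∀ s : Finset V, Q (s.piecewise x x₀) := by
    intro s
    induction s using Finset.induction_on with
    | empty => simpa using h₀
    | insert i s hi ih =>
      rw [Finset.piecewise_insert]
      by_cases h : x i = s.piecewise x x₀ i
      · rw [h, Function.update_eq_self]; exact ih
      · have : x i = !(s.piecewise x x₀ i) := by
          revert h; cases x i <;> cases s.piecewise x x₀ i <;> simp
        rw [this]
        exact hflip i _ ih
  simpa using key Finset.univ

theorem eq_top_of_flip_mem_of_swap_mem [Fintype V] (M : Submonoid (Equiv.Perm (V → Bool)))
    (hflip : ∀ t, flip t ∈ M)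
    (hswap : ∀ t, Equiv.swap (fun _ => true) (flip t (fun _ => true)) ∈ M) : M = ⊤ := by
  have hadj : ∀ x : V → Bool, ∀ t, Equiv.swap x (flip t x) ∈ M := by
    refine flip_induction (fun _ => true) hswap fun i x hx t => ?_
    -- Conjugation by `flip i`, its own inverse, moves the edge at `x` to the parallel edge at `flip
    -- i x`.
    have : Equiv.swap (flip i x) (flip t (flip i x)) =
        flip i * Equiv.swap x (flip t x) * flip i := by
      rw [flip_comm, Equiv.swap_apply_apply]
      congr 1
    rw [this]
    exact M.mul_mem (M.mul_mem (hflip i) (hx t)) (hflip i)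
  have hall : ∀ x y : V → Bool, Equiv.swap x y ∈ M := fun x =>
    flip_induction x (by rw [Equiv.swap_self]; exact M.one_mem)
      fun i y hy => SubmonoidClass.swap_mem_trans M hy (hadj y i)
  rw [eq_top_iff, ← Equiv.Perm.mclosure_isSwap, Submonoid.closure_le]
  rintro σ ⟨x, y, -, rfl⟩
  exact hall x y

/-- The two swapped points are exactly those with ones everywhere off `t`, where the controls fire.
-/
theorem swap_true_flip_apply [Fintype V] (t : V) (x : V → Bool) :
    Equiv.swap (fun _ => true) (flip t (fun _ => true)) x = mct (Finset.univ.erase t) t x := by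
  by_cases h : ∀ p, p ≠ t → x p = true
  · have hx : x = Function.update (fun _ => true) t (x t) := by
      funext w
      by_cases hw : w = t
      · subst hw; simp
      · simp [hw, h w hw]
    have hd : mct (Finset.univ.erase t) t x = Function.update x t (!x t) :=
      mct_of_forall (by simpa using h)
    rw [hd]
    cases hxt : x t <;> rw [hxt] at hx
    · have : x = flip t (fun _ => true) := by rw [hx, flip_apply]; simp
      rw [this, Equiv.swap_apply_right]
      simp [flip_apply]
    · have : x = fun _ => true := by rw [hx]; simp
      rw [this, Equiv.swap_apply_left]
      rfl
  · have hd : mct (Finset.univ.erase t) t x = x :=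
      mct_of_not_forall (by simpa using h)
    rw [hd]
    refine Equiv.swap_apply_of_ne_of_ne ?_ ?_
    · rintro rfl
      exact h fun _ _ => rfl
    · rintro rfl
      exact h fun p hp => by simp [flip_apply, hp]

theorem elim_mct_eq {U : Type} [DecidableEq U] (P : Finset V) (t : V) (x : V → Bool)
    (y : U → Bool) :
    mct (P.map Function.Embedding.inl) (Sum.inl t) (Sum.elim x y) = Sum.elim (mct P t x) y := by
  have : (∀ p ∈ P.map Function.Embedding.inl, Sum.elim x y p = true) ↔ ∀ p ∈ P, x p = true :=
    Finset.forall_mem_map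
  simp only [mct, this, Sum.elim_inl, Sum.update_elim_inl]

theorem freePerms_eq_top [Fintype V] (a b k : ℕ) (j : Fin k)
    (hnot : ∀ t, flip t ∈ freePerms V a b 0 k)
    (hcnot : ∀ i t, i ≠ t → ∃ C : Circuit (V ⊕ Fin k), C.cost a b 0 = 0 ∧
      ∀ x : V → Bool, C.run (Sum.elim x (fun _ => true)) =
        Sum.elim (mct {i} t x) (fun _ => true)) :
    freePerms V a b 0 k = ⊤ := by
  refine eq_top_of_flip_mem_of_swap_mem _ hnot fun t => ?_
  -- With at most two variables the fully controlled NOT is just a NOT or a CNOT.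
  rcases Nat.lt_or_ge (Finset.univ.erase t).card 2 with h1 | h2
  · obtain h0 | h1 : (Finset.univ.erase t).card = 0 ∨ (Finset.univ.erase t).card = 1 := by omega
    · obtain ⟨C, hC, hr⟩ := hnot t
      refine ⟨C, hC, fun x => ?_⟩
      rw [hr, swap_true_flip_apply, Finset.card_eq_zero.mp h0,
        mct_of_forall (fun p hp => absurd hp (Finset.notMem_empty p)), flip_apply]
    · obtain ⟨i, hi⟩ := Finset.card_eq_one.mp h1
      have hit : i ≠ t := Finset.ne_of_mem_erase (hi ▸ Finset.mem_singleton_self i)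
      obtain ⟨C, hC, hr⟩ := hcnot i t hit
      refine ⟨C, hC, fun x => ?_⟩
      rw [hr, swap_true_flip_apply, hi]
  · obtain ⟨C, hC, hr⟩ := exists_toffoli_circuit a b
      ((Finset.univ.erase t).map (Function.Embedding.inl : V ↪ V ⊕ Fin k)) (by simpa using h2)
      (Sum.inl t) (Sum.inr j) (by simp) (by simp) (by simp)
    refine ⟨C, hC, fun x => ?_⟩
    rw [hr, swap_true_flip_apply, elim_mct_eq]

/-- The form `xor (x t) true` is what NOT, and any gate controlled by ones only, reduces to by
definition. -/
theorem elim_flip_eq {U : Type} [DecidableEq U] (t : V) (x : V → Bool) (y : U → Bool) :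
    Function.update (Sum.elim x y) (Sum.inl t) (xor (x t) true) = Sum.elim (flip t x) y := by
  rw [Sum.update_elim_inl, flip_apply, Bool.xor_true]

theorem elim_mct_singleton_eq {U : Type} [DecidableEq U] (i t : V) (x : V → Bool)
    (y : U → Bool) :
    Function.update (Sum.elim x y) (Sum.inl t) (xor (x t) (x i)) =
      Sum.elim (mct {i} t x) y := by
  rw [Sum.update_elim_inl]
  simp only [mct, Finset.mem_singleton, forall_eq, Bool.decide_eq_true]

theorem freePerms_cnot_free [Fintype V] : freePerms V 0 1 0 1 = ⊤ := by
  refine freePerms_eq_top 0 1 1 0 (fun t => ⟨[.not (.inl t)], rfl, fun x => ?_⟩)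
    (fun i t hit => ⟨[.tof (.inl i) (.inr 0) (.inl t) (by simp) (by simpa using hit) (by simp)],
      rfl, fun x => ?_⟩)
  · exact elim_flip_eq t x _
  -- `x i && true` does not reduce to `x i` for a variable `x i`, hence the explicit rewriting.
  · refine Eq.trans ?_ (elim_mct_singleton_eq i t x _)
    exact congrArg (fun v => Function.update (Sum.elim x _) (Sum.inl t) (xor (x t) v))
      (Bool.and_true (x i))

theorem freePerms_not_free [Fintype V] : freePerms V 1 0 0 1 = ⊤ := by
  refine freePerms_eq_top 1 0 1 0
    (fun t => ⟨[.cnot (.inr 0) (.inl t) (by simp)], rfl, fun x => ?_⟩)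
    (fun i t hit => ⟨[.cnot (.inl i) (.inl t) (by simpa using hit)], rfl, fun x => ?_⟩)
  · exact elim_flip_eq t x _
  · exact elim_mct_singleton_eq i t x _

theorem freePerms_toffoli [Fintype V] : freePerms V 1 1 0 2 = ⊤ := by
  refine freePerms_eq_top 1 1 2 0
    (fun t => ⟨[.tof (.inr 0) (.inr 1) (.inl t) (by simp) (by simp) (by simp)], rfl,
      fun x => ?_⟩)
    (fun i t hit => ⟨[.tof (.inl i) (.inr 0) (.inl t) (by simp) (by simpa using hit) (by simp)],
      rfl, fun x => ?_⟩)
  · exact elim_flip_eq t x _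
  · refine Eq.trans ?_ (elim_mct_singleton_eq i t x _)
    exact congrArg (fun v => Function.update (Sum.elim x _) (Sum.inl t) (xor (x t) v))
      (Bool.and_true (x i))

end Universality

/-- The permutation `(x, y) ↦ (x, y ⊕ f x)`. -/
def xorPerm {n : ℕ} (f : RevFun n) : Equiv.Perm (Fin n ⊕ Fin n → Bool) :=
  Function.Involutive.toPerm
    (fun s => Sum.elim (fun i => s (.inl i))
      (fun i => xor (s (.inr i)) (f (fun j => s (.inl j)) i)))
    (fun s => by funext w; cases w <;> simp)

/-- Intermediate implementation of `f` is strong implementation of `xorPerm f` on `2n` variables;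
weak follows from strong. -/
theorem zero_mem_costs (m : Notion) (a b c k : ℕ) {n : ℕ} (f : RevFun n)
    (h₁ : freePerms (Fin n) a b c k = ⊤) (h₂ : freePerms (Fin n ⊕ Fin n) a b c k = ⊤) :
    0 ∈ costs m a b c f (fun _ : Fin k => true) := by
  obtain ⟨C, hC, hr⟩ : f ∈ freePerms (Fin n) a b c k := h₁ ▸ Submonoid.mem_top f
  obtain ⟨D, hD, hs⟩ : xorPerm f ∈ freePerms (Fin n ⊕ Fin n) a b c k :=
    h₂ ▸ Submonoid.mem_top _
  cases m with
  | weak => exact ⟨C, ⟨Sum.inl, fun x i => by rw [hr]; rfl⟩, hC⟩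
  | intermediate => exact ⟨D, fun x y => by rw [hs]; rfl, hD⟩
  | strong => exact ⟨C, hr, hC⟩

theorem L_eq_zero (m : Notion) (a b c k n g : ℕ) (hk : k ≤ g)
    (h : ∀ f : RevFun n, 0 ∈ costs m a b c f (fun _ : Fin k => true)) : L m a b c n g = 0 := by
  refine nonpos_iff_eq_zero.mp (iSup_le fun f => ?_)
  exact iInf₂_le_of_le k hk (iInf_le_of_le (fun _ => true)
    (iInf₂_le_of_le 0 (h f) (by simp)))

end NCT

theorem mainTheorem7 (m : NCT.Notion) (n : ℕ) :
    ((∀ g : ℕ, 1 ≤ g → NCT.L m 0 1 0 n g = 0) ∧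
      (∀ g : ℕ, 1 ≤ g → NCT.L m 1 0 0 n g = 0) ∧
      (∀ g : ℕ, 2 ≤ g → NCT.L m 1 1 0 n g = 0)) ∧
    (∀ f : NCT.RevFun n,
      0 ∈ NCT.costs m 0 1 0 f (fun _ : Fin 1 => true) ∧
      0 ∈ NCT.costs m 1 0 0 f (fun _ : Fin 1 => true) ∧
      0 ∈ NCT.costs m 1 1 0 f (fun _ : Fin 2 => true)) := by
  have hA : ∀ f : NCT.RevFun n, 0 ∈ NCT.costs m 0 1 0 f (fun _ : Fin 1 => true) := fun f =>
    NCT.zero_mem_costs m 0 1 0 1 f NCT.freePerms_cnot_free NCT.freePerms_cnot_free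
  have hB : ∀ f : NCT.RevFun n, 0 ∈ NCT.costs m 1 0 0 f (fun _ : Fin 1 => true) := fun f =>
    NCT.zero_mem_costs m 1 0 0 1 f NCT.freePerms_not_free NCT.freePerms_not_free
  have hC : ∀ f : NCT.RevFun n, 0 ∈ NCT.costs m 1 1 0 f (fun _ : Fin 2 => true) := fun f =>
    NCT.zero_mem_costs m 1 1 0 2 f NCT.freePerms_toffoli NCT.freePerms_toffoli
  exact ⟨⟨fun g hg => NCT.L_eq_zero m 0 1 0 1 n g hg hA,
    fun g hg => NCT.L_eq_zero m 1 0 0 1 n g hg hB,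
    fun g hg => NCT.L_eq_zero m 1 1 0 2 n g hg hC⟩, fun f => ⟨hA f, hB f, hC f⟩⟩
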